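/- There is an absolute constant $c$ and a deterministic one-way two-player protocol with the following property. Let $\mathcal{N}$ be a finite ground set partitioned into $\mathcal{N}_A$ and $\mathcal{N}_B$, let $M=(\mathcal{N},\mathcal{I})$ be a matroid of rank $k$, and let $f\colon 2^{\mathcal{N}}\to\mathbb{R}_{\ge 0}$ be a non-negative monotone submodular function. Alice, who is given only $\mathcal{N}_A$ and, by value and independence oracles, the values of $f$ and the independence of the subsets of $\mathcal{N}_A$, sends to Bob a set $Q\subseteq\mathcal{N}_A$ of at most $c\,k$ elements. Bob, who is given only $Q$, $\mathcal{N}_B$, and the values of $f$ and the independence of the subsets of $Q\cup\mathcal{N}_B$, returns an independent set $R\in\mathcal{I}$ with $R\subseteq Q\cup\mathcal{N}_B$ and $$f(R)\;\ge\;0.505\cdot\max\{f(I)\colon I\in\mathcal{I}\}.$$ -/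

import Mathlib

/-- A non-negative monotone submodular set function on the subsets of the finite ground set `N`
(the values of `f` outside `N` play no role). -/
structure IsMonotoneSubmodularOn {α : Type*} [DecidableEq α] (N : Finset α)
    (f : Finset α → ℝ) : Prop where
  nonneg : ∀ S, S ⊆ N → 0 ≤ f S
  monotone : ∀ S, S ⊆ N → ∀ u ∈ N, 0 ≤ f (insert u S) - f S
  submodular : ∀ S T, S ⊆ T → T ⊆ N → ∀ u ∈ N \ T,
    f (insert u T) - f T ≤ f (insert u S) - f S

/-- A deterministic one-way two-player protocol for maximizing a set function under an
independence constraint, for elements from the universe `α`.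

Alice sees her elements `A`, an independence oracle and a value oracle, both defined only on the
subsets of `A`, and sends a subset of `A` to Bob.  Bob sees the received set `Q`, his own elements
`B`, and both oracles on the subsets of `Q ∪ B` only, and returns a subset of `Q ∪ B`. -/
structure TwoPlayerProtocol (α : Type*) [DecidableEq α] where
  alice : (A : Finset α) → ({S : Finset α // S ⊆ A} → Prop) →
    ({S : Finset α // S ⊆ A} → ℝ) → Finset α
  alice_subset : ∀ A indep val, alice A indep val ⊆ A
  bob : (Q B : Finset α) → ({S : Finset α // S ⊆ Q ∪ B} → Prop) →
    ({S : Finset α // S ⊆ Q ∪ B} → ℝ) → Finset α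
  bob_subset : ∀ Q B indep val, bob Q B indep val ⊆ Q ∪ B

namespace TwoPlayerProtocol

/-- The set of elements that Alice sends when she holds `A`, the constraint is the matroid `M`
and the objective function is `f`. -/
def message {α : Type*} [DecidableEq α] (P : TwoPlayerProtocol α) (M : Matroid α)
    (f : Finset α → ℝ) (A : Finset α) : Finset α :=
  P.alice A (fun S => M.Indep (S.1 : Set α)) (fun S => f S.1)

/-- The set that Bob returns when Alice holds `A` and Bob holds `B`. -/
def output {α : Type*} [DecidableEq α] (P : TwoPlayerProtocol α) (M : Matroid α)
    (f : Finset α → ℝ) (A B : Finset α) : Finset α :=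
  P.bob (P.message M f A) B (fun S => M.Indep (S.1 : Set α)) (fun S => f S.1)

end TwoPlayerProtocol

/-! Alice sends her best independent set and thirteen successive greedy bases S_0, ..., S_12 of her
part, at most 14k elements. Bob returns the best independent set that he sees, of value v. Write
F(y) for the expected value of f on a random set whose elements are included independently with the
probabilities listed in y, and let y_k be the sum of (1/8) S_j over j < k. Each base is greedy for f
with the earlier picks, including those of its own round, already present with probability 1/8 each.

Let X ∪ C be an optimal set, of value Z, with X on Alice's side and C on Bob's. Alice does not know
C. Still, an exchange argument finds in every S_j a subset S'_j that is independent together with C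
and gains at least 1/8 of what X would add to y_{j+1} (`IsGreedyRun.exists_gain`). Let y'_k be the
sum of (1/8) S'_j over j < k, and put p_k = F(y'_k), q_k = F(y_k), E_k = F(y'_k + C). Submodularity
gives p_{k+1} - p_k ≥ (Z - E_{k+1} + p_{k+1} - q_{k+1}) / 8.

Upper bounds on E and q come from swap rounding: a convex combination of available independent sets
is worth at most v, also on top of C in the contraction by C (`expect_sum_uniform_le`). Hence E_k ≤
v for k ≤ 8. Filling y_k up to total weight one with X, or with C, and adding the two bounds keeps
q_k well below v in the early rounds if v is close to Z/2; this is the gain over 1/2. For k > 8 the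
weight exceeds one, and concavity of F along nonnegative directions allows scaling back by 8/k
(`le_expect_scale`). If v < 0.505 Z, these linear inequalities push p_13 above E_13, against
monotonicity (`contradiction_of_recursion`). -/

/-! ### Random sets as operators on set functions. -/

/-- A monotone submodular function on all finite sets. -/
structure MonotoneSubmodular {α : Type*} [DecidableEq α] (f : Finset α → ℝ) : Prop where
  mono : ∀ S T, S ⊆ T → f S ≤ f T
  submod : ∀ S T u, S ⊆ T → f (insert u T) - f T ≤ f (insert u S) - f S

/-- All increments of `g` are bounded by the corresponding increments of `h`. -/
def MarginalLE {α : Type*} (g h : Finset α → ℝ) : Prop :=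
  ∀ S T, S ⊆ T → g T - g S ≤ h T - h S

/-- The expectation of `f` when the element `x.2` is added with probability `x.1`. -/
def mix {α : Type*} [DecidableEq α] (x : ℝ × α) (f : Finset α → ℝ) : Finset α → ℝ :=
  fun S => (1 - x.1) * f S + x.1 * f (insert x.2 S)

/-- Independent additions commute, so folding over a multiset is well defined. An element may occur
several times in the multiset; each occurrence is a separate independent chance. -/
instance mix_leftCommutative {α : Type*} [DecidableEq α] :
    LeftCommutative (mix : ℝ × α → (Finset α → ℝ) → (Finset α → ℝ)) where
  left_comm x y f := by
    funext S
    simp only [mix]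
    rw [Finset.insert_comm x.2 y.2]
    ring

/-- The expectation of `f` when the elements listed in `m` are added independently, each with the
probability that it carries. -/
def expect {α : Type*} [DecidableEq α] (m : Multiset (ℝ × α)) (f : Finset α → ℝ) :
    Finset α → ℝ :=
  m.foldr mix f

/-- The elements of `S`, each with probability `p`. -/
def uniform {α : Type*} (p : ℝ) (S : Finset α) : Multiset (ℝ × α) :=
  S.val.map (Prod.mk p)

/-- All weights in `m` are probabilities. -/
def IsProb {α : Type*} (m : Multiset (ℝ × α)) : Prop := ∀ x ∈ m, 0 ≤ x.1 ∧ x.1 ≤ 1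

/-! ### Multisets of weighted elements. -/

section Weights

variable {α : Type*}

theorem MarginalLE.trans {f g h : Finset α → ℝ} (h₁ : MarginalLE f g) (h₂ : MarginalLE g h) :
    MarginalLE f h := fun S T hST => (h₁ S T hST).trans (h₂ S T hST)

theorem IsProb.add {m n : Multiset (ℝ × α)} (hm : IsProb m) (hn : IsProb n) : IsProb (m + n) :=
  fun x hx => (Multiset.mem_add.1 hx).elim (hm x) (hn x)

theorem IsProb.mono {m n : Multiset (ℝ × α)} (hn : IsProb n) (h : m ≤ n) : IsProb m :=
  fun x hx => hn x (Multiset.mem_of_le h hx)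

theorem isProb_sum {ι : Type*} (s : Finset ι) (m : ι → Multiset (ℝ × α))
    (h : ∀ i ∈ s, IsProb (m i)) : IsProb (∑ i ∈ s, m i) := by
  intro x hx
  obtain ⟨i, hi, hxi⟩ := Multiset.mem_sum.1 hx
  exact h i hi x hxi

theorem isProb_uniform {p : ℝ} (h0 : 0 ≤ p) (h1 : p ≤ 1) (S : Finset α) :
    IsProb (uniform p S) := by
  intro x hx
  obtain ⟨u, _, rfl⟩ := Multiset.mem_map.1 hx
  exact ⟨h0, h1⟩

theorem uniform_mono (p : ℝ) {S T : Finset α} (h : S ⊆ T) : uniform p S ≤ uniform p T :=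
  Multiset.map_le_map (Finset.val_le_iff.2 h)

@[simp] theorem uniform_empty (p : ℝ) : uniform p (∅ : Finset α) = 0 := rfl

theorem map_scale_uniform (c p : ℝ) (S : Finset α) :
    ((uniform p S).map fun x => (c * x.1, x.2)) = uniform (c * p) S := by
  simp [uniform, Multiset.map_map]

end Weights

/-! ### The multilinear extension: monotonicity, submodularity, concavity. -/

section Operators

variable {α : Type*} [DecidableEq α]

theorem MonotoneSubmodular.union_sub_le {f : Finset α → ℝ} (hf : MonotoneSubmodular f)
    {S T : Finset α} (h : S ⊆ T) (X : Finset α) : f (T ∪ X) - f T ≤ f (S ∪ X) - f S := by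
  induction X using Finset.induction_on with
  | empty => simp
  | insert u X _ ih =>
    have := hf.submod (S ∪ X) (T ∪ X) u (Finset.union_subset_union_left h)
    rw [Finset.union_insert, Finset.union_insert]
    linarith

theorem MonotoneSubmodular.sub_le_sum {f : Finset α → ℝ} (hf : MonotoneSubmodular f)
    (X : Finset α) : f X - f ∅ ≤ ∑ o ∈ X, (f {o} - f ∅) := by
  induction X using Finset.induction_on with
  | empty => simp
  | insert u X hu ih =>
    have := hf.submod ∅ X u (Finset.empty_subset _)
    rw [Finset.sum_insert hu]
    simp only [insert_empty_eq] at this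
    linarith

theorem MonotoneSubmodular.union_right {f : Finset α → ℝ} (hf : MonotoneSubmodular f)
    (X : Finset α) : MonotoneSubmodular (fun S => f (S ∪ X)) where
  mono S T h := hf.mono _ _ (Finset.union_subset_union_left h)
  submod S T u h := by
    have := hf.submod (S ∪ X) (T ∪ X) u (Finset.union_subset_union_left h)
    simpa only [Finset.insert_union] using this

theorem MarginalLE.mix {g h : Finset α → ℝ} (hgh : MarginalLE g h) {x : ℝ × α}
    (hx : 0 ≤ x.1 ∧ x.1 ≤ 1) : MarginalLE (mix x g) (mix x h) := by
  intro S T hST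
  have h1 := mul_le_mul_of_nonneg_left (hgh S T hST) (sub_nonneg.2 hx.2)
  have h2 := mul_le_mul_of_nonneg_left
    (hgh (insert x.2 S) (insert x.2 T) (Finset.insert_subset_insert _ hST)) hx.1
  simp only [_root_.mix]
  linarith

theorem mix_marginalLE {f : Finset α → ℝ} (hf : MonotoneSubmodular f) {x : ℝ × α}
    (hx : 0 ≤ x.1 ∧ x.1 ≤ 1) : MarginalLE (mix x f) f := by
  intro S T hST
  have := mul_le_mul_of_nonneg_left (hf.submod S T x.2 hST) hx.1
  simp only [mix]
  linarith

theorem MonotoneSubmodular.mix {f : Finset α → ℝ} (hf : MonotoneSubmodular f) {x : ℝ × α}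
    (hx : 0 ≤ x.1 ∧ x.1 ≤ 1) : MonotoneSubmodular (mix x f) where
  mono S T hST := by
    have h1 := mul_le_mul_of_nonneg_left (hf.mono S T hST) (sub_nonneg.2 hx.2)
    have h2 := mul_le_mul_of_nonneg_left
      (hf.mono (insert x.2 S) (insert x.2 T) (Finset.insert_subset_insert _ hST)) hx.1
    simp only [_root_.mix]
    linarith
  submod S T u hST := by
    have h1 := mul_le_mul_of_nonneg_left (hf.submod S T u hST) (sub_nonneg.2 hx.2)
    have h2 := mul_le_mul_of_nonneg_left
      (hf.submod (insert x.2 S) (insert x.2 T) u (Finset.insert_subset_insert _ hST)) hx.1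
    simp only [_root_.mix]
    rw [Finset.insert_comm x.2 u T, Finset.insert_comm x.2 u S]
    linarith

theorem le_mix {f : Finset α → ℝ} (hf : MonotoneSubmodular f) {x : ℝ × α} (hx : 0 ≤ x.1)
    (S : Finset α) : f S ≤ mix x f S := by
  have := mul_le_mul_of_nonneg_left (hf.mono S (insert x.2 S) (Finset.subset_insert _ _)) hx
  simp only [mix]
  linarith

theorem mix_mono {f g : Finset α → ℝ} (h : ∀ S, f S ≤ g S) {x : ℝ × α}
    (hx : 0 ≤ x.1 ∧ x.1 ≤ 1) (S : Finset α) : mix x f S ≤ mix x g S := by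
  have h1 := mul_le_mul_of_nonneg_left (h S) (sub_nonneg.2 hx.2)
  have h2 := mul_le_mul_of_nonneg_left (h (insert x.2 S)) hx.1
  simp only [mix]
  linarith

theorem uniform_insert (p : ℝ) {S : Finset α} {u : α} (h : u ∉ S) :
    uniform p (insert u S) = (p, u) ::ₘ uniform p S := by
  simp [uniform, Finset.insert_val_of_notMem h]

theorem uniform_union (p : ℝ) {S T : Finset α} (h : Disjoint S T) :
    uniform p (S ∪ T) = uniform p S + uniform p T := by
  rw [← Finset.disjUnion_eq_union S T h]
  simp [uniform, Finset.disjUnion]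

@[simp] theorem expect_zero (f : Finset α → ℝ) : expect 0 f = f := rfl

@[simp] theorem expect_cons (x : ℝ × α) (m : Multiset (ℝ × α)) (f : Finset α → ℝ) :
    expect (x ::ₘ m) f = mix x (expect m f) := Multiset.foldr_cons ..

theorem expect_add (m n : Multiset (ℝ × α)) (f : Finset α → ℝ) :
    expect (m + n) f = expect m (expect n f) := Multiset.foldr_add ..

theorem expect_comm (m n : Multiset (ℝ × α)) (f : Finset α → ℝ) :
    expect m (expect n f) = expect n (expect m f) := by
  rw [← expect_add, ← expect_add, add_comm]

theorem expect_mix (m : Multiset (ℝ × α)) (x : ℝ × α) (f : Finset α → ℝ) :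
    expect m (mix x f) = mix x (expect m f) := by
  have h := expect_comm m {x} f
  have hx : ∀ g : Finset α → ℝ, expect {x} g = mix x g := fun g => Multiset.foldr_singleton ..
  rwa [hx, hx] at h

theorem MonotoneSubmodular.expect {f : Finset α → ℝ} (hf : MonotoneSubmodular f)
    {m : Multiset (ℝ × α)} (hm : IsProb m) : MonotoneSubmodular (expect m f) := by
  induction m using Multiset.induction_on with
  | empty => simpa
  | cons x m ih =>
    rw [expect_cons]
    exact (ih (hm.mono (Multiset.le_cons_self _ _))).mix (hm x (Multiset.mem_cons_self _ _))

theorem le_expect {f : Finset α → ℝ} (hf : MonotoneSubmodular f)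
    {m : Multiset (ℝ × α)} (hm : IsProb m) (S : Finset α) : f S ≤ expect m f S := by
  induction m using Multiset.induction_on with
  | empty => simp
  | cons x m ih =>
    have hm' := hm.mono (Multiset.le_cons_self m x)
    rw [expect_cons]
    exact (ih hm').trans (le_mix (hf.expect hm') (hm x (Multiset.mem_cons_self _ _)).1 S)

theorem expect_marginalLE {f : Finset α → ℝ} (hf : MonotoneSubmodular f)
    {m : Multiset (ℝ × α)} (hm : IsProb m) : MarginalLE (expect m f) f := by
  induction m using Multiset.induction_on with
  | empty => intro S T _; simp
  | cons x m ih =>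
    have hm' := hm.mono (Multiset.le_cons_self m x)
    rw [expect_cons]
    exact (mix_marginalLE (hf.expect hm') (hm x (Multiset.mem_cons_self _ _))).trans (ih hm')

theorem expect_mono {f g : Finset α → ℝ} (h : ∀ S, f S ≤ g S)
    {m : Multiset (ℝ × α)} (hm : IsProb m) (S : Finset α) : expect m f S ≤ expect m g S := by
  induction m using Multiset.induction_on generalizing S with
  | empty => simpa using h S
  | cons x m ih =>
    rw [expect_cons, expect_cons]
    exact mix_mono (ih (hm.mono (Multiset.le_cons_self m x)))
      (hm x (Multiset.mem_cons_self _ _)) S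

theorem expect_le_expect_of_le {f : Finset α → ℝ} (hf : MonotoneSubmodular f)
    {m n : Multiset (ℝ × α)} (h : m ≤ n) (hn : IsProb n) (S : Finset α) :
    expect m f S ≤ expect n f S := by
  obtain ⟨d, rfl⟩ := Multiset.le_iff_exists_add.1 h
  rw [expect_add]
  exact expect_mono (le_expect hf (hn.mono (Multiset.le_add_left _ _)))
    (hn.mono (Multiset.le_add_right _ _)) S

theorem expect_marginalLE_of_le {f : Finset α → ℝ} (hf : MonotoneSubmodular f)
    {m n : Multiset (ℝ × α)} (h : m ≤ n) (hn : IsProb n) :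
    MarginalLE (expect n f) (expect m f) := by
  obtain ⟨d, rfl⟩ := Multiset.le_iff_exists_add.1 h
  rw [add_comm, expect_add]
  exact expect_marginalLE (hf.expect (hn.mono (Multiset.le_add_right _ _)))
    (hn.mono (Multiset.le_add_left _ _))

theorem expect_union_right (m : Multiset (ℝ × α)) (f : Finset α → ℝ) (S X : Finset α) :
    expect m f (S ∪ X) = expect m (fun S => f (S ∪ X)) S := by
  induction m using Multiset.induction_on generalizing S with
  | empty => simp
  | cons x m ih =>
    simp only [expect_cons, mix]
    rw [← ih, ← ih, Finset.insert_union]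

/-- Scaling all probabilities by `c` loses at most the factor `c`. -/
theorem le_expect_scale {f : Finset α → ℝ} (hf : MonotoneSubmodular f)
    {m : Multiset (ℝ × α)} (hm : IsProb m) {c : ℝ} (h0 : 0 ≤ c) (h1 : c ≤ 1) (S : Finset α) :
    (1 - c) * f S + c * expect m f S ≤ expect (m.map fun x => (c * x.1, x.2)) f S := by
  induction m using Multiset.induction_on generalizing S with
  | empty => simp only [expect_zero, Multiset.map_zero]; linarith
  | cons x m ih =>
    have hm' := hm.mono (Multiset.le_cons_self m x)
    obtain ⟨hx0, hx1⟩ := hm x (Multiset.mem_cons_self _ _)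
    have hcx : 0 ≤ c * x.1 := mul_nonneg h0 hx0
    have hcx1 : 0 ≤ 1 - c * x.1 := by nlinarith
    rw [Multiset.map_cons, expect_cons, expect_cons]
    simp only [mix]
    have i1 := mul_le_mul_of_nonneg_left (ih hm' S) hcx1
    have i2 := mul_le_mul_of_nonneg_left (ih hm' (insert x.2 S)) hcx
    -- The two induction hypotheses are weighted by c * x.1 where the claim has both c and x.1
    -- separately; the difference is paid for by increments shrinking under `expect`.
    have i3 := mul_le_mul_of_nonneg_left
      (expect_marginalLE hf hm' S (insert x.2 S) (Finset.subset_insert _ _))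
      (mul_nonneg hcx (sub_nonneg.2 h1))
    linarith

theorem expect_uniform_one (S X : Finset α) (f : Finset α → ℝ) :
    expect (uniform 1 S) f X = f (S ∪ X) := by
  induction S using Finset.induction_on generalizing X with
  | empty => simp
  | insert u S hu ih =>
    rw [uniform_insert 1 hu, expect_cons]
    simp only [mix, ih]
    rw [Finset.union_insert, Finset.insert_union]
    ring

theorem le_expect_uniform {f : Finset α → ℝ} (hf : MonotoneSubmodular f) (S X : Finset α) {p : ℝ}
    (h0 : 0 ≤ p) (h1 : p ≤ 1) :
    (1 - p) * f X + p * f (S ∪ X) ≤ expect (uniform p S) f X := by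
  have := le_expect_scale hf (isProb_uniform zero_le_one le_rfl S) h0 h1 X
  rwa [map_scale_uniform, expect_uniform_one, mul_one] at this

end Operators

/-! ### Swap rounding in a matroid. -/

section Rounding

/-- Symmetric basis exchange. -/
theorem Matroid.IsBase.exists_symm_exchange {α : Type*} {M : Matroid α} {B₁ B₂ : Set α} {i : α}
    (h₁ : M.IsBase B₁) (h₂ : M.IsBase B₂) (hi₁ : i ∈ B₁) (hi₂ : i ∉ B₂) :
    ∃ j ∈ B₂, j ∉ B₁ ∧ M.IsBase (insert j (B₁ \ {i})) ∧ M.IsBase (insert i (B₂ \ {j})) := by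
  have hiE : i ∈ M.E := h₁.subset_ground hi₁
  have hC := h₂.fundCircuit_isCircuit hiE hi₂
  -- Otherwise the closure of B₁ \ {i} would contain the rest of the circuit and hence i itself.
  obtain ⟨j, hjC, hj⟩ : ∃ j ∈ M.fundCircuit i B₂ \ {i}, j ∉ M.closure (B₁ \ {i}) := by
    by_contra! hall
    have h := hC.mem_closure_sdiff_singleton_of_mem (M.mem_fundCircuit i B₂)
    exact h₁.indep.notMem_closure_sdiff_of_mem hi₁
      (M.closure_subset_closure_of_subset_closure hall h)
  have hj₂ : j ∈ B₂ := (M.fundCircuit_subset_insert i B₂ hjC.1).resolve_left hjC.2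
  have hj₁ : j ∉ B₁ := fun h => hj (M.mem_closure_of_mem' ⟨h, hjC.2⟩ (h₂.subset_ground hj₂))
  have hcl : i ∈ M.closure B₂ := by rwa [h₂.closure_eq]
  have hind := (h₂.indep.mem_fundCircuit_iff hcl hi₂).1 hjC.1
  have hb := h₂.exchange_isBase_of_indep' hj₂ hi₂ hind
  rw [← Set.insert_sdiff_singleton_comm (fun h => hjC.2 h.symm)] at hb
  exact ⟨j, hj₂, hj₁, h₁.exchange_base_of_notMem_closure hi₁ hj (h₂.subset_ground hj₂), hb⟩

variable {α : Type*} [DecidableEq α]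

/-- Two independent chances a and b include an element with probability a + b - ab only. -/
theorem expect_uniform_add_le {f : Finset α → ℝ} (hf : MonotoneSubmodular f) {a b : ℝ}
    (ha : 0 ≤ a) (hb : 0 ≤ b) (hab : a + b ≤ 1) (X S : Finset α) :
    expect (uniform a X + uniform b X) f S ≤ expect (uniform (a + b) X) f S := by
  induction X using Finset.induction_on generalizing S with
  | empty => simp
  | insert u X hu ih =>
    rw [uniform_insert a hu, uniform_insert b hu, uniform_insert (a + b) hu, Multiset.cons_add,
      Multiset.add_cons, expect_cons, expect_cons, expect_cons]
    have hm : IsProb (uniform a X + uniform b X) :=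
      (isProb_uniform ha (by linarith) X).add (isProb_uniform hb (by linarith) X)
    refine le_trans ?_ (mix_mono ih (x := (a + b, u)) ⟨add_nonneg ha hb, hab⟩ S)
    have := mul_le_mul_of_nonneg_left ((hf.expect hm).mono S (insert u S) (Finset.subset_insert _ _))
      (mul_nonneg ha hb)
    simp only [mix, Finset.insert_idem]
    linarith

/-- By submodularity the value is at most (1 - a - b) f(S) + a f(S + i) + b f(S + j); moving all
weight to the better of i and j only helps. This replaces the random choice of swap rounding by a
deterministic one. -/
theorem mix_mix_le_max {f : Finset α → ℝ} (hf : MonotoneSubmodular f) {a b : ℝ}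
    (ha : 0 ≤ a) (hb : 0 ≤ b) (i j : α) (S : Finset α) :
    mix (a, i) (mix (b, j) f) S ≤ max (mix (a + b, i) f S) (mix (a + b, j) f S) := by
  have h := mul_le_mul_of_nonneg_left (hf.submod S (insert i S) j (Finset.subset_insert _ _))
    (mul_nonneg ha hb)
  rw [le_max_iff]
  simp only [mix]
  rcases le_total (f (insert i S)) (f (insert j S)) with hij | hij
  · right
    have := mul_le_mul_of_nonneg_left hij ha
    linarith
  · left
    have := mul_le_mul_of_nonneg_left hij hb
    linarith

theorem expect_uniform_le {f : Finset α → ℝ} (hf : MonotoneSubmodular f) {p : ℝ}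
    (h0 : 0 ≤ p) (h1 : p ≤ 1) {S X C : Finset α} (hS : S ⊆ C) (hX : X ⊆ C) :
    expect (uniform p S) f X ≤ f C := by
  induction S using Finset.induction_on generalizing X with
  | empty => simpa using hf.mono X C hX
  | insert u S hu ih =>
    obtain ⟨huC, hSC⟩ := Finset.insert_subset_iff.1 hS
    have i1 := mul_le_mul_of_nonneg_left (ih hSC hX) (sub_nonneg.2 h1)
    have i2 := mul_le_mul_of_nonneg_left (ih hSC (Finset.insert_subset huC hX)) h0
    rw [uniform_insert p hu, expect_cons]
    simp only [mix]
    linarith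

/-- Swap rounding of two bases whose common part has already been merged. -/
theorem exists_isBase_merge_sdiff {M : Matroid α} {a b : ℝ} (ha : 0 ≤ a) (hb : 0 ≤ b)
    (hab : a + b ≤ 1) {f : Finset α → ℝ} (hf : MonotoneSubmodular f) (n : ℕ) :
    ∀ B₁ B₂ : Finset α, M.IsBase (B₁ : Set α) → M.IsBase (B₂ : Set α) → (B₁ \ B₂).card = n →
      ∃ C : Finset α, M.IsBase (C : Set α) ∧
        expect (uniform a (B₁ \ B₂) + uniform b (B₂ \ B₁) + uniform (a + b) (B₁ ∩ B₂)) f ∅ ≤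
          expect (uniform (a + b) C) f ∅ := by
  induction n with
  | zero =>
    intro B₁ B₂ h₁ h₂ hn
    have hsub : B₁ ⊆ B₂ := Finset.sdiff_eq_empty_iff_subset.1 (Finset.card_eq_zero.1 hn)
    have heq : B₁ = B₂ := by
      have := h₁.eq_of_subset_isBase h₂ (by exact_mod_cast hsub)
      exact_mod_cast this
    subst heq
    exact ⟨B₁, h₁, by simp⟩
  | succ n ih =>
    intro B₁ B₂ h₁ h₂ hn
    obtain ⟨i, hi⟩ := Finset.card_pos.1 (by omega : 0 < (B₁ \ B₂).card)
    obtain ⟨hi₁, hi₂⟩ := Finset.mem_sdiff.1 hi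
    obtain ⟨j, hj₂, hj₁, hb₁, hb₂⟩ := h₁.exists_symm_exchange h₂
      (Finset.mem_coe.2 hi₁) (fun h => hi₂ (Finset.mem_coe.1 h))
    rw [Finset.mem_coe] at hj₂ hj₁
    have hij : i ≠ j := fun h => hi₂ (h ▸ hj₂)
    set D₁ := (B₁ \ B₂).erase i with hD₁
    set D₂ := (B₂ \ B₁).erase j with hD₂
    have e₁ : B₁ \ B₂ = insert i D₁ := (Finset.insert_erase hi).symm
    have e₂ : B₂ \ B₁ = insert j D₂ :=
      (Finset.insert_erase (Finset.mem_sdiff.2 ⟨hj₂, hj₁⟩)).symm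
    have hcard : D₁.card = n := by rw [hD₁, Finset.card_erase_of_mem hi, hn]; rfl
    set g := expect (uniform a D₁ + uniform b D₂ + uniform (a + b) (B₁ ∩ B₂)) f with hg
    have hgm : MonotoneSubmodular g := hf.expect
      (((isProb_uniform ha (by linarith) _).add (isProb_uniform hb (by linarith) _)).add
        (isProb_uniform (by linarith) hab _))
    have hL : expect (uniform a (B₁ \ B₂) + uniform b (B₂ \ B₁) + uniform (a + b) (B₁ ∩ B₂)) f
        = mix (a, i) (mix (b, j) g) := by
      rw [e₁, e₂, uniform_insert a (Finset.notMem_erase _ _),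
        uniform_insert b (Finset.notMem_erase _ _)]
      simp only [Multiset.cons_add, Multiset.add_cons, expect_cons, hg]
      exact LeftCommutative.left_comm _ _ _
    rw [hL]
    -- If i wins it replaces j in B₂, otherwise j replaces i in B₁. Either way the winner joins the
    -- common part with weight a + b and the difference shrinks by one.
    rcases le_max_iff.1 (mix_mix_le_max hgm ha hb i j ∅) with h | h
    · have hb₂' : M.IsBase ((insert i (B₂.erase j) : Finset α) : Set α) := by
        simpa using hb₂
      have s₁ : B₁ \ insert i (B₂.erase j) = D₁ := by
        ext x; simp only [hD₁, Finset.mem_sdiff, Finset.mem_insert, Finset.mem_erase]; grind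
      have s₂ : insert i (B₂.erase j) \ B₁ = D₂ := by
        ext x; simp only [hD₂, Finset.mem_sdiff, Finset.mem_insert, Finset.mem_erase]; grind
      have s₃ : B₁ ∩ insert i (B₂.erase j) = insert i (B₁ ∩ B₂) := by
        ext x; simp only [Finset.mem_inter, Finset.mem_insert, Finset.mem_erase]; grind
      obtain ⟨C, hC, hle⟩ := ih B₁ _ h₁ hb₂' (by rw [s₁, hcard])
      refine ⟨C, hC, h.trans (le_trans (le_of_eq ?_) hle)⟩
      rw [s₁, s₂, s₃, uniform_insert (a + b) (fun hh => hi₂ (Finset.mem_inter.1 hh).2),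
        Multiset.add_cons, expect_cons]
    · have hb₁' : M.IsBase ((insert j (B₁.erase i) : Finset α) : Set α) := by
        simpa using hb₁
      have s₁ : insert j (B₁.erase i) \ B₂ = D₁ := by
        ext x; simp only [hD₁, Finset.mem_sdiff, Finset.mem_insert, Finset.mem_erase]; grind
      have s₂ : B₂ \ insert j (B₁.erase i) = D₂ := by
        ext x; simp only [hD₂, Finset.mem_sdiff, Finset.mem_insert, Finset.mem_erase]; grind
      have s₃ : insert j (B₁.erase i) ∩ B₂ = insert j (B₁ ∩ B₂) := by
        ext x; simp only [Finset.mem_inter, Finset.mem_insert, Finset.mem_erase]; grind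
      obtain ⟨C, hC, hle⟩ := ih _ B₂ hb₁' h₂ (by rw [s₁, hcard])
      refine ⟨C, hC, h.trans (le_trans (le_of_eq ?_) hle)⟩
      rw [s₁, s₂, s₃, uniform_insert (a + b) (fun hh => hj₁ (Finset.mem_inter.1 hh).1),
        Multiset.add_cons, expect_cons]

/-- Swap rounding of two bases. -/
theorem exists_isBase_merge {M : Matroid α} {a b : ℝ} (ha : 0 ≤ a) (hb : 0 ≤ b)
    (hab : a + b ≤ 1) {f : Finset α → ℝ} (hf : MonotoneSubmodular f) {B₁ B₂ : Finset α}
    (h₁ : M.IsBase (B₁ : Set α)) (h₂ : M.IsBase (B₂ : Set α)) :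
    ∃ C : Finset α, M.IsBase (C : Set α) ∧
      expect (uniform a B₁ + uniform b B₂) f ∅ ≤ expect (uniform (a + b) C) f ∅ := by
  obtain ⟨C, hC, hle⟩ := exists_isBase_merge_sdiff ha hb hab hf _ B₁ B₂ h₁ h₂ rfl
  refine ⟨C, hC, le_trans ?_ hle⟩
  have e₁ : uniform a B₁ = uniform a (B₁ \ B₂) + uniform a (B₁ ∩ B₂) := by
    rw [← uniform_union a (Finset.disjoint_sdiff_inter B₁ B₂), Finset.sdiff_union_inter]
  have e₂ : uniform b B₂ = uniform b (B₂ \ B₁) + uniform b (B₁ ∩ B₂) := by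
    rw [Finset.inter_comm, ← uniform_union b (Finset.disjoint_sdiff_inter B₂ B₁),
      Finset.sdiff_union_inter]
  rw [e₁, e₂, add_add_add_comm, expect_add, expect_add (uniform a (B₁ \ B₂) + uniform b (B₂ \ B₁))]
  exact expect_mono (expect_uniform_add_le hf ha hb hab (B₁ ∩ B₂))
    ((isProb_uniform ha (by linarith) _).add (isProb_uniform hb (by linarith) _)) ∅

/-- Bases are merged one at a time. While the other sets are being merged, the set I i is absorbed
into the objective, which stays monotone and submodular. -/
theorem exists_isBase_merge_sum {ι : Type*} {M : Matroid α} [M.Finite] (s : Finset ι)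
    {w : ι → ℝ} (hw : ∀ i ∈ s, 0 ≤ w i) (hsum : ∑ i ∈ s, w i ≤ 1) {I : ι → Finset α}
    (hI : ∀ i ∈ s, M.Indep (I i : Set α)) {f : Finset α → ℝ} (hf : MonotoneSubmodular f) :
    ∃ C : Finset α, M.IsBase (C : Set α) ∧
      expect (∑ i ∈ s, uniform (w i) (I i)) f ∅ ≤ expect (uniform (∑ i ∈ s, w i) C) f ∅ := by
  classical
  induction s using Finset.induction_on generalizing f with
  | empty =>
    obtain ⟨B, hB⟩ := M.exists_isBase
    obtain ⟨C, rfl⟩ := hB.finite.exists_finset_coe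
    exact ⟨C, hB, by simpa using le_expect hf (isProb_uniform le_rfl zero_le_one C) ∅⟩
  | insert i s hi ih =>
    have hs : ∀ j ∈ s, 0 ≤ w j := fun j hj => hw j (Finset.mem_insert_of_mem hj)
    have hwi := hw i (Finset.mem_insert_self _ _)
    have hs0 := Finset.sum_nonneg hs
    rw [Finset.sum_insert hi] at hsum
    have hp := isProb_uniform hwi (by linarith) (I i)
    obtain ⟨C, hC, hle⟩ := ih hs (by linarith)
      (fun j hj => hI j (Finset.mem_insert_of_mem hj)) (hf.expect hp)
    obtain ⟨B, hB, hIB⟩ := (hI i (Finset.mem_insert_self _ _)).exists_isBase_superset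
    obtain ⟨D, rfl⟩ := hB.finite.exists_finset_coe
    obtain ⟨C', hC', hle'⟩ := exists_isBase_merge hwi hs0 hsum hf hB hC
    refine ⟨C', hC', ?_⟩
    rw [Finset.sum_insert hi, Finset.sum_insert hi]
    refine le_trans ?_ hle'
    rw [add_comm (uniform _ _), expect_add]
    refine hle.trans ?_
    rw [← expect_add, add_comm]
    exact expect_le_expect_of_le hf
      (add_le_add (uniform_mono _ (Finset.coe_subset.1 hIB)) le_rfl)
      ((isProb_uniform hwi (by linarith) _).add (isProb_uniform hs0 (by linarith) _)) ∅

/-- A convex combination of independent sets can be rounded to an independent set. -/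
theorem exists_indep_expect_le {ι : Type*} {M : Matroid α} [M.Finite] (s : Finset ι)
    {w : ι → ℝ} (hw : ∀ i ∈ s, 0 ≤ w i) (hsum : ∑ i ∈ s, w i ≤ 1) {I : ι → Finset α}
    (hI : ∀ i ∈ s, M.Indep (I i : Set α)) {f : Finset α → ℝ} (hf : MonotoneSubmodular f) :
    ∃ C : Finset α, M.Indep (C : Set α) ∧ expect (∑ i ∈ s, uniform (w i) (I i)) f ∅ ≤ f C := by
  obtain ⟨C, hC, hle⟩ := exists_isBase_merge_sum s hw hsum hI hf
  refine ⟨C, hC.indep, hle.trans ?_⟩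
  exact expect_uniform_le hf (Finset.sum_nonneg hw) hsum subset_rfl (Finset.empty_subset _)

end Rounding

/-! ### Greedy bases and the exchange argument against an unknown set C. -/

section Greedy

variable {α : Type*} [DecidableEq α]

/-- `IsGreedyRun Ind δ g I S`: starting from the set `I`, the elements of `S` are added one at a
time, always one of largest current value among those that keep the set independent, until the set
is maximal; each addition replaces the objective by its expectation when the new element is
included with probability `δ`. -/
inductive IsGreedyRun (Ind : Finset α → Prop) (δ : ℝ) :
    (Finset α → ℝ) → Finset α → Finset α → Prop
  | nil (g : Finset α → ℝ) (I : Finset α) (hmax : ∀ v, v ∉ I → ¬ Ind (insert v I)) :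
      IsGreedyRun Ind δ g I ∅
  | cons (g : Finset α → ℝ) (I : Finset α) (u : α) (S : Finset α) (huI : u ∉ I) (huS : u ∉ S)
      (hind : Ind (insert u I)) (hbest : ∀ v, v ∉ I → Ind (insert v I) → g {v} ≤ g {u})
      (hrun : IsGreedyRun Ind δ (mix (δ, u) g) (insert u I) S) :
      IsGreedyRun Ind δ g I (insert u S)

theorem exists_isGreedyRun {Ind : Finset α → Prop} {A : Finset α} (hA : ∀ S, Ind S → S ⊆ A)
    (δ : ℝ) (n : ℕ) : ∀ (g : Finset α → ℝ) (I : Finset α), (A \ I).card = n →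
      ∃ S, Disjoint S I ∧ IsGreedyRun Ind δ g I S := by
  classical
  induction n with
  | zero =>
    intro g I hn
    refine ⟨∅, Finset.disjoint_empty_left _, .nil g I fun v hv hind => hv ?_⟩
    exact Finset.sdiff_eq_empty_iff_subset.1 (Finset.card_eq_zero.1 hn)
      (hA _ hind (Finset.mem_insert_self _ _))
  | succ n ih =>
    intro g I hn
    by_cases hne : (A.filter fun v => v ∉ I ∧ Ind (insert v I)).Nonempty
    · obtain ⟨u, hu, hmax⟩ := Finset.exists_max_image _ (fun v => g {v}) hne
      obtain ⟨huA, huI, hind⟩ := Finset.mem_filter.1 hu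
      obtain ⟨S, hdis, hrun⟩ := ih (mix (δ, u) g) (insert u I) (by
        rw [Finset.sdiff_insert, Finset.card_erase_of_mem (Finset.mem_sdiff.2 ⟨huA, huI⟩), hn]
        rfl)
      rw [Finset.disjoint_insert_right] at hdis
      refine ⟨insert u S, Finset.disjoint_insert_left.2 ⟨huI, hdis.2⟩,
        .cons g I u S huI hdis.1 hind (fun v hv hvI => hmax v ?_) hrun⟩
      exact Finset.mem_filter.2 ⟨hA _ hvI (Finset.mem_insert_self _ _), hv, hvI⟩
    · refine ⟨∅, Finset.disjoint_empty_left _, .nil g I fun v hv hind => hne ⟨v, ?_⟩⟩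
      exact Finset.mem_filter.2 ⟨hA _ hind (Finset.mem_insert_self _ _), hv, hind⟩

theorem IsGreedyRun.indep_union {Ind : Finset α → Prop} {δ : ℝ} {g : Finset α → ℝ}
    {I S : Finset α} (hrun : IsGreedyRun Ind δ g I S) (hI : Ind I) : Ind (S ∪ I) := by
  induction hrun with
  | nil g I hmax => simpa
  | cons g I u S huI huS hind hbest hrun ih =>
    have := ih hind
    rwa [Finset.union_insert, ← Finset.insert_union] at this

/-- Greedy evaluates only subsets of A, so Alice's run, made with her restricted oracle, is also a
run for the function on the whole ground set. -/
theorem IsGreedyRun.congr {Ind : Finset α → Prop} {A : Finset α} (hA : ∀ S, Ind S → S ⊆ A)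
    {δ : ℝ} {g g' : Finset α → ℝ} {I S : Finset α} (hrun : IsGreedyRun Ind δ g I S)
    (h : ∀ S, S ⊆ A → g S = g' S) : IsGreedyRun Ind δ g' I S := by
  induction hrun generalizing g' with
  | nil g I hmax => exact .nil g' I hmax
  | cons g I u S huI huS hind hbest hrun ih =>
    have hmem : ∀ v, Ind (insert v I) → ({v} : Finset α) ⊆ A := fun v hv =>
      Finset.singleton_subset_iff.2 (hA _ hv (Finset.mem_insert_self _ _))
    refine .cons g' I u S huI huS hind (fun v hv hvI => ?_) (ih fun T hT => ?_)
    · rw [← h _ (hmem v hvI), ← h _ (hmem u hind)]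
      exact hbest v hv hvI
    · simp only [mix]
      rw [h T hT, h _ (Finset.insert_subset (hmem u hind (Finset.mem_singleton_self u)) hT)]

theorem expect_congr {A : Finset α} {f g : Finset α → ℝ} (h : ∀ S, S ⊆ A → f S = g S)
    {m : Multiset (ℝ × α)} (hm : ∀ x ∈ m, x.2 ∈ A) {S : Finset α} (hS : S ⊆ A) :
    expect m f S = expect m g S := by
  induction m using Multiset.induction_on generalizing S with
  | empty => exact h S hS
  | cons x m ih =>
    have hm' : ∀ y ∈ m, y.2 ∈ A := fun y hy => hm y (Multiset.mem_cons_of_mem hy)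
    simp only [expect_cons, mix]
    rw [ih hm' hS, ih hm' (Finset.insert_subset (hm x (Multiset.mem_cons_self _ _)) hS)]

/-- Adding an element outside the closure of `C` to the independent set `X ∪ C` costs at most one
element of `X`. -/
theorem Matroid.Indep.exists_exchange_into {M : Matroid α} {X C : Finset α}
    (h : M.Indep ((X ∪ C : Finset α) : Set α)) {u : α} (huE : u ∈ M.E)
    (hu : u ∉ M.closure (C : Set α)) :
    ∃ X' ⊆ X, (X' = X ∨ ∃ o ∈ X, X' = X.erase o) ∧ u ∉ X' ∧
      M.Indep ((X' ∪ insert u C : Finset α) : Set α) := by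
  have hCE : (C : Set α) ⊆ M.E := by
    refine subset_trans ?_ h.subset_ground
    exact_mod_cast Finset.subset_union_right
  have huC : u ∉ C := fun hc => hu (M.mem_closure_of_mem (Finset.mem_coe.2 hc) hCE)
  by_cases huX : u ∈ X
  · refine ⟨X.erase u, Finset.erase_subset _ _, .inr ⟨u, huX, rfl⟩, Finset.notMem_erase _ _, ?_⟩
    rwa [Finset.union_insert, ← Finset.insert_union, Finset.insert_erase huX]
  by_cases hind : M.Indep (insert u ((X ∪ C : Finset α) : Set α))
  · refine ⟨X, subset_rfl, .inl rfl, huX, ?_⟩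
    rwa [Finset.union_insert, Finset.coe_insert]
  have huXC : u ∉ ((X ∪ C : Finset α) : Set α) := by simp [huX, huC]
  have hcl : u ∈ M.closure ((X ∪ C : Finset α) : Set α) := by
    by_contra hcl
    exact hind ((h.insert_indep_iff).2 (.inl ⟨huE, hcl⟩))
  have hK := h.fundCircuit_isCircuit hcl huXC
  -- The circuit closed by u must leave C, since u is not spanned by C; any of its elements in X can
  -- be given up.
  obtain ⟨o, ⟨hoK, hou⟩, hoC⟩ :
      ∃ o ∈ M.fundCircuit u ((X ∪ C : Finset α) : Set α) \ {u}, o ∉ (C : Set α) := by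
    by_contra! hall
    exact hu (M.closure_subset_closure hall
      (hK.mem_closure_sdiff_singleton_of_mem (M.mem_fundCircuit _ _)))
  have hoX : o ∈ X := by
    have := (M.fundCircuit_subset_insert u _ hoK).resolve_left hou
    rw [Finset.mem_coe, Finset.mem_union] at this
    exact this.resolve_right (fun hc => hoC (Finset.mem_coe.2 hc))
  refine ⟨X.erase o, Finset.erase_subset _ _, .inr ⟨o, hoX, rfl⟩,
    fun hh => huX (Finset.mem_of_mem_erase hh), ?_⟩
  refine ((h.mem_fundCircuit_iff hcl huXC).1 hoK).subset ?_
  intro x hx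
  simp only [Finset.coe_union, Finset.coe_insert, Finset.coe_erase] at hx
  have hou' : u ≠ o := fun e => hou e.symm
  simp only [Set.mem_sdiff, Set.mem_insert_iff, Set.mem_singleton_iff, Finset.coe_union,
    Set.mem_union, Finset.mem_coe] at hx hoC ⊢
  grind

/-- Follow the run while keeping X ∪ C independent and I spanned by C. A pick u spanned by C is
discarded; any other pick is kept and moved into C, at the cost of at most one o in X. Such an o was
still available to greedy, so u was at least as good and pays for o. When I is maximal, X is used
up. The function h sees only the kept picks, so its increments continue to dominate those of g. -/
theorem IsGreedyRun.exists_exchange {M : Matroid α} {A : Finset α} {Ind : Finset α → Prop}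
    (hInd : ∀ S, Ind S ↔ S ⊆ A ∧ M.Indep (S : Set α)) (hAE : (A : Set α) ⊆ M.E) {δ : ℝ}
    (h0 : 0 ≤ δ) (h1 : δ ≤ 1) {g : Finset α → ℝ} {I S : Finset α}
    (hrun : IsGreedyRun Ind δ g I S) (hg : MonotoneSubmodular g) :
    ∀ X C : Finset α, X ⊆ A → Disjoint X C → M.Indep ((X ∪ C : Finset α) : Set α) → Ind I →
      (I : Set α) ⊆ M.closure (C : Set α) →
      ∃ S' ⊆ S, Disjoint S' C ∧ M.Indep ((S' ∪ C : Finset α) : Set α) ∧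
        ∀ h, MonotoneSubmodular h → MarginalLE g h →
          δ * ∑ o ∈ X, (expect (uniform δ S) g {o} - expect (uniform δ S) g ∅) ≤
            expect (uniform δ S') h ∅ - h ∅ := by
  have avail : ∀ {X C I : Finset α}, X ⊆ A → Disjoint X C →
      M.Indep ((X ∪ C : Finset α) : Set α) → Ind I → (I : Set α) ⊆ M.closure (C : Set α) →
      ∀ o ∈ X, o ∉ I ∧ Ind (insert o I) := by
    intro X C I hXA hdis hXC hI hIC o ho
    have hoC : o ∉ M.closure (C : Set α) := by
      have hi : M.Indep (insert o (C : Set α)) := hXC.subset (by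
        intro x hx
        rcases hx with rfl | hx <;> simp_all)
      have hC : M.Indep (C : Set α) := hi.subset (Set.subset_insert _ _)
      exact (hC.notMem_closure_iff_of_notMem
        (fun hc => (Finset.disjoint_left.1 hdis ho (Finset.mem_coe.1 hc)))
        (hAE (Finset.mem_coe.2 (hXA ho)))).2 hi
    have hoI : o ∉ M.closure (I : Set α) := fun hh =>
      hoC (M.closure_subset_closure_of_subset_closure hIC hh)
    obtain ⟨hIA, hIi⟩ := (hInd I).1 hI
    refine ⟨fun hh => hoC (hIC (Finset.mem_coe.2 hh)), (hInd _).2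
      ⟨Finset.insert_subset (hXA ho) hIA, ?_⟩⟩
    rw [Finset.coe_insert]
    exact hIi.insert_indep_iff.2 (.inl ⟨hAE (Finset.mem_coe.2 (hXA ho)), hoI⟩)
  induction hrun with
  | nil g I hmax =>
    intro X C hXA hdis hXC hI hIC
    have hX : X = ∅ := Finset.eq_empty_of_forall_notMem fun o ho =>
      hmax o (avail hXA hdis hXC hI hIC o ho).1 (avail hXA hdis hXC hI hIC o ho).2
    refine ⟨∅, subset_rfl, Finset.disjoint_empty_left _, ?_, fun h _ _ => by simp [hX]⟩
    simpa [hX] using hXC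
  | cons g I u S huI huS hind hbest hrun ih =>
    intro X C hXA hdis hXC hI hIC
    have hδ : 0 ≤ ((δ, u) : ℝ × α).1 ∧ ((δ, u) : ℝ × α).1 ≤ 1 := ⟨h0, h1⟩
    have hS : expect (uniform δ (insert u S)) g = expect (uniform δ S) (mix (δ, u) g) := by
      rw [uniform_insert δ huS, expect_cons, expect_mix]
    rw [hS]
    have huE : u ∈ M.E := hAE (Finset.mem_coe.2 (((hInd _).1 hind).1 (Finset.mem_insert_self _ _)))
    have hgm := hg.mix hδ
    by_cases hu : u ∈ M.closure (C : Set α)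
    · obtain ⟨S', hS', hd, hi, hle⟩ := ih hgm X C hXA hdis hXC hind (by
        rw [Finset.coe_insert]; exact Set.insert_subset hu hIC)
      exact ⟨S', hS'.trans (Finset.subset_insert _ _), hd, hi,
        fun h hh hgh => hle h hh ((mix_marginalLE hg hδ).trans hgh)⟩
    · obtain ⟨X', hX'X, hX', huX', hXC'⟩ := hXC.exists_exchange_into huE hu
      have hCE : ((insert u C : Finset α) : Set α) ⊆ M.E := by
        refine subset_trans ?_ hXC'.subset_ground
        exact_mod_cast Finset.subset_union_right
      have hCcl := M.subset_closure _ hCE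
      have hIcl : ((insert u I : Finset α) : Set α) ⊆ M.closure ((insert u C : Finset α) : Set α) := by
        rw [Finset.coe_insert u I]
        refine Set.insert_subset (hCcl (by simp)) (hIC.trans (M.closure_subset_closure ?_))
        exact_mod_cast Finset.subset_insert _ _
      obtain ⟨S', hS', hd, hi, hle⟩ := ih hgm X' (insert u C) (hX'X.trans hXA)
        (Finset.disjoint_insert_right.2 ⟨huX', Finset.disjoint_of_subset_left hX'X hdis⟩)
        hXC' hind hIcl
      rw [Finset.disjoint_insert_right] at hd
      have huC : u ∉ C := by
        intro hc
        exact hu (M.mem_closure_of_mem (Finset.mem_coe.2 hc)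
          (subset_trans (by exact_mod_cast Finset.subset_insert _ _) hCE))
      refine ⟨insert u S', Finset.insert_subset_insert _ hS',
        Finset.disjoint_insert_left.2 ⟨huC, hd.2⟩, ?_, fun h hh hgh => ?_⟩
      · rwa [Finset.insert_union, ← Finset.union_insert]
      · have hrec := hle _ (hh.mix hδ) (hgh.mix hδ)
        rw [uniform_insert δ hd.1, expect_cons, ← expect_mix]
        have hmix : mix (δ, u) h ∅ - h ∅ = δ * (h {u} - h ∅) := by
          simp only [mix, insert_empty_eq]; ring
        rcases hX' with rfl | ⟨o, ho, rfl⟩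
        · have := le_mix hh (x := (δ, u)) h0 ∅
          linarith
        · obtain ⟨hoI, hoind⟩ := avail hXA hdis hXC hI hIC o ho
          -- The increment of o after the run is at most its increment when u was picked, hence at
          -- most that of u for g, hence for h.
          have k1 := expect_marginalLE hgm (isProb_uniform h0 h1 S) ∅ {o} (Finset.empty_subset _)
          have k2 := mix_marginalLE hg hδ ∅ {o} (Finset.empty_subset _)
          have k3 := hbest o hoI hoind
          have k4 := hgh ∅ {u} (Finset.empty_subset _)
          have k5 : expect (uniform δ S) (mix (δ, u) g) {o}
              - expect (uniform δ S) (mix (δ, u) g) ∅ ≤ h {u} - h ∅ := by linarith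
          have k6 := mul_le_mul_of_nonneg_left k5 h0
          rw [← Finset.add_sum_erase X _ ho, mul_add]
          linarith

/-- Every base found by a greedy run contains, for each independent set `X ∪ C`, a subset which is
independent of `C` and whose gain compares with the remaining gain of `X`. -/
theorem IsGreedyRun.exists_gain {M : Matroid α} {A : Finset α} {Ind : Finset α → Prop}
    (hInd : ∀ S, Ind S ↔ S ⊆ A ∧ M.Indep (S : Set α)) (hAE : (A : Set α) ⊆ M.E) {δ : ℝ}
    (h0 : 0 ≤ δ) (h1 : δ ≤ 1) {g : Finset α → ℝ} {S : Finset α}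
    (hrun : IsGreedyRun Ind δ g ∅ S) (hg : MonotoneSubmodular g) {X C : Finset α} (hXA : X ⊆ A)
    (hdis : Disjoint X C) (hXC : M.Indep ((X ∪ C : Finset α) : Set α)) :
    ∃ S' ⊆ S, Disjoint S' C ∧ M.Indep ((S' ∪ C : Finset α) : Set α) ∧
      ∀ h, MonotoneSubmodular h → MarginalLE g h →
        δ * (expect (uniform δ S) g X - expect (uniform δ S) g ∅) ≤
          expect (uniform δ S') h ∅ - h ∅ := by
  obtain ⟨S', hS', hd, hi, hle⟩ := hrun.exists_exchange hInd hAE h0 h1 hg X C hXA hdis hXC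
    ((hInd _).2 ⟨Finset.empty_subset _, by simp⟩) (by simp)
  refine ⟨S', hS', hd, hi, fun h hh hgh => le_trans ?_ (hle h hh hgh)⟩
  exact mul_le_mul_of_nonneg_left
    ((hg.expect (isProb_uniform h0 h1 S)).sub_le_sum X) h0

end Greedy

/-! ### The recursion for the values and its contradiction. -/

section Analysis

theorem map_scale_sum_uniform {α : Type*} (c p : ℝ) (S : ℕ → Finset α) (k : ℕ) :
    ((∑ j ∈ Finset.range k, uniform p (S j)).map fun x => (c * x.1, x.2)) =
      ∑ j ∈ Finset.range k, uniform (c * p) (S j) := by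
  induction k with
  | zero => simp
  | succ k ih => rw [Finset.sum_range_succ, Finset.sum_range_succ, Multiset.map_add, ih,
      map_scale_uniform]

/-- The recursion satisfied by the values that arise in the analysis is contradictory. -/
theorem contradiction_of_recursion {v Z : ℝ} {p q E : ℕ → ℝ} (hv0 : 0 ≤ v) (hv : v < 0.505 * Z)
    (hp0 : 0 ≤ p 0)
    (hp : ∀ k < 13, p k + (1 / 8) * (Z - E (k + 1) + p (k + 1) - q (k + 1)) ≤ p (k + 1))
    (hpE : p 13 ≤ E 13)
    (hE : ∀ k ≤ 8, E k ≤ v)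
    (hE' : ∀ k : ℕ, 8 ≤ k → k ≤ 13 → 8 * E k ≤ k * v - (k - 8) * (Z - v))
    (hq : ∀ k : ℕ, k ≤ 8 → (8 - k) * (Z + q k) + 2 * k * q k ≤ 16 * v)
    (hq' : ∀ k : ℕ, 8 ≤ k → k ≤ 13 → 8 * q k ≤ k * v) : False := by
  -- Solved for p (k + 1), each step reads p (k + 1) ≥ (8/7) p k + (Z - E - q)/7. At v = Z/2 the
  -- first eight rounds force p 8 only to about 0.384 Z, below the bound Z/2 on E; the factor 8/7
  -- lifts p past it in later rounds, which is why the total weight must exceed one.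
  have a1 := hp 0 (by norm_num)
  have a2 := hp 1 (by norm_num)
  have a3 := hp 2 (by norm_num)
  have a4 := hp 3 (by norm_num)
  have a5 := hp 4 (by norm_num)
  have a6 := hp 5 (by norm_num)
  have a7 := hp 6 (by norm_num)
  have a8 := hp 7 (by norm_num)
  have a9 := hp 8 (by norm_num)
  have a10 := hp 9 (by norm_num)
  have a11 := hp 10 (by norm_num)
  have a12 := hp 11 (by norm_num)
  have a13 := hp 12 (by norm_num)
  have e1 := hE 1 (by norm_num)
  have e2 := hE 2 (by norm_num)
  have e3 := hE 3 (by norm_num)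
  have e4 := hE 4 (by norm_num)
  have e5 := hE 5 (by norm_num)
  have e6 := hE 6 (by norm_num)
  have e7 := hE 7 (by norm_num)
  have e8 := hE 8 (by norm_num)
  have e9 := hE' 9 (by norm_num) (by norm_num)
  have e10 := hE' 10 (by norm_num) (by norm_num)
  have e11 := hE' 11 (by norm_num) (by norm_num)
  have e12 := hE' 12 (by norm_num) (by norm_num)
  have e13 := hE' 13 (by norm_num) (by norm_num)
  have q1 := hq 1 (by norm_num)
  have q2 := hq 2 (by norm_num)
  have q3 := hq 3 (by norm_num)
  have q4 := hq 4 (by norm_num)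
  have q5 := hq 5 (by norm_num)
  have q6 := hq 6 (by norm_num)
  have q7 := hq 7 (by norm_num)
  have q8 := hq 8 (by norm_num)
  have q9 := hq' 9 (by norm_num) (by norm_num)
  have q10 := hq' 10 (by norm_num) (by norm_num)
  have q11 := hq' 11 (by norm_num) (by norm_num)
  have q12 := hq' 12 (by norm_num) (by norm_num)
  have q13 := hq' 13 (by norm_num) (by norm_num)
  norm_num at *
  linarith

variable {α : Type*} [DecidableEq α]

/-- Rounding in a contraction: a convex combination of sets that are independent of `C`, added to
`C`, is worth at most the best independent set. -/
theorem expect_sum_uniform_le {M : Matroid α} {U C : Finset α}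
    (hC : M.Indep (C : Set α)) (hCU : C ⊆ U) {f : Finset α → ℝ} (hf : MonotoneSubmodular f) {v : ℝ}
    (hv : ∀ I : Finset α, I ⊆ U → M.Indep (I : Set α) → f I ≤ v) {ι : Type*} (s : Finset ι)
    {w : ι → ℝ} (hw : ∀ i ∈ s, 0 ≤ w i) (hsum : ∑ i ∈ s, w i ≤ 1) {I : ι → Finset α}
    (hIU : ∀ i ∈ s, I i ⊆ U) (hIC : ∀ i ∈ s, Disjoint (I i) C)
    (hI : ∀ i ∈ s, M.Indep ((I i ∪ C : Finset α) : Set α)) :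
    expect (∑ i ∈ s, uniform (w i) (I i)) f C ≤ v := by
  -- Restricting to U before contracting C keeps the rounded set inside U, where v is an upper
  -- bound.
  have : Matroid.Finite ((M.restrict (U : Set α)).contract (C : Set α)) :=
    ⟨U.finite_toSet.subset ((Matroid.contract_ground _ _).trans_subset Set.sdiff_subset)⟩
  have hCi : (M.restrict (U : Set α)).Indep (C : Set α) :=
    Matroid.restrict_indep_iff.2 ⟨hC, by exact_mod_cast hCU⟩
  obtain ⟨R, hR, hle⟩ := exists_indep_expect_le (M := (M.restrict (U : Set α)).contract (C : Set α)) s hw hsum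
    (I := I) (fun i hi => hCi.contract_indep_iff.2 ⟨Finset.disjoint_coe.2 (hIC i hi),
      Matroid.restrict_indep_iff.2 ⟨by simpa using hI i hi, by
        exact_mod_cast Finset.union_subset (hIU i hi) hCU⟩⟩) (hf.union_right C)
  obtain ⟨-, hRC⟩ := hCi.contract_indep_iff.1 hR
  obtain ⟨hRi, hRU⟩ := Matroid.restrict_indep_iff.1 hRC
  rw [← expect_union_right, Finset.empty_union] at hle
  exact hle.trans (hv _ (by exact_mod_cast hRU) (by exact_mod_cast hRi))

/-- Concavity along nonnegative directions: shrinking all weights by c turns an overfull sum of sets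
into a convex combination, which can be rounded on top of C. -/
theorem scaled_expect_le {M : Matroid α} {U C : Finset α}
    (hC : M.Indep (C : Set α)) (hCU : C ⊆ U) {f : Finset α → ℝ} (hf : MonotoneSubmodular f) {v : ℝ}
    (hv : ∀ I : Finset α, I ⊆ U → M.Indep (I : Set α) → f I ≤ v) {δ c : ℝ} (hδ0 : 0 ≤ δ)
    (hδ1 : δ ≤ 1) (hc0 : 0 ≤ c) (hc1 : c ≤ 1) {S : ℕ → Finset α} {k : ℕ} (hk : k * (c * δ) ≤ 1)
    (hSU : ∀ j < k, S j ⊆ U) (hSC : ∀ j < k, Disjoint (S j) C)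
    (hS : ∀ j < k, M.Indep ((S j ∪ C : Finset α) : Set α)) :
    (1 - c) * f C + c * expect (∑ j ∈ Finset.range k, uniform δ (S j)) f C ≤ v := by
  refine (le_expect_scale hf (isProb_sum _ _ fun j _ => isProb_uniform hδ0 hδ1 (S j))
    hc0 hc1 C).trans ?_
  rw [map_scale_sum_uniform]
  refine expect_sum_uniform_le hC hCU hf hv _ (fun _ _ => mul_nonneg hc0 hδ0) (by simpa using hk)
    ?_ ?_ ?_ <;> intro j hj <;> rw [Finset.mem_range] at hj
  exacts [hSU j hj, hSC j hj, hS j hj]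

/-- The k sets carry weight kδ; giving the missing 1 - kδ to X yields a convex combination that can
be rounded, and concavity in the weight of X bounds its value from below. -/
theorem convex_expect_le {M : Matroid α} {U X : Finset α}
    (hX : M.Indep (X : Set α)) (hXU : X ⊆ U) {f : Finset α → ℝ} (hf : MonotoneSubmodular f) {v : ℝ}
    (hv : ∀ I : Finset α, I ⊆ U → M.Indep (I : Set α) → f I ≤ v) {δ : ℝ} (hδ0 : 0 ≤ δ)
    (hδ1 : δ ≤ 1) {S : ℕ → Finset α} {k : ℕ} (hk : k * δ ≤ 1)
    (hSU : ∀ j < k, S j ⊆ U) (hS : ∀ j < k, M.Indep (S j : Set α)) :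
    (1 - k * δ) * expect (∑ j ∈ Finset.range k, uniform δ (S j)) f X
      + k * δ * expect (∑ j ∈ Finset.range k, uniform δ (S j)) f ∅ ≤ v := by
  set y := ∑ j ∈ Finset.range k, uniform δ (S j) with hy
  have hkδ : 0 ≤ k * δ := by positivity
  have hyp : IsProb y := isProb_sum _ _ fun j _ => isProb_uniform hδ0 hδ1 (S j)
  have h1 := le_expect_uniform (hf.expect hyp) X ∅ (p := 1 - k * δ) (by linarith) (by linarith)
  have hlast : ∀ j ∈ Finset.range k, j ≠ k := fun j hj => (Finset.mem_range.1 hj).ne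
  -- The extra index k carries X.
  have hsum : ∑ j ∈ Finset.range (k + 1), uniform (if j = k then 1 - k * δ else δ)
      (if j = k then X else S j) = uniform (1 - k * δ) X + y := by
    rw [Finset.sum_range_succ, add_comm, hy]
    simp only [if_true]
    congr 1
    exact Finset.sum_congr rfl fun j hj => by simp [hlast j hj]
  have h2 : expect (uniform (1 - k * δ) X + y) f ∅ ≤ v := by
    rw [← hsum]
    refine expect_sum_uniform_le (M := M) (U := U) (by simp) (Finset.empty_subset _) hf hv _
      ?_ ?_ ?_ (fun _ _ => Finset.disjoint_empty_right _) ?_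
    · intro j _
      split_ifs <;> linarith
    · rw [Finset.sum_range_succ, Finset.sum_congr rfl fun j hj => if_neg (hlast j hj)]
      simp
    · intro j hj
      split_ifs with h
      · exact hXU
      · exact hSU j (by have := Finset.mem_range.1 hj; omega)
    · intro j hj
      rw [Finset.union_empty]
      split_ifs with h
      · exact hX
      · exact hS j (by have := Finset.mem_range.1 hj; omega)
  rw [expect_add] at h2
  rw [Finset.union_empty] at h1
  linarith

/-- If thirteen successive greedy bases of `A` with step `1 / 8` are available in `U`, then the best
independent set within `U` or `A` has at least `0.505` times the value of any independent set
`X ∪ C` with `X ⊆ A` and `C ⊆ U`. -/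
theorem greedy_bases_guarantee {M : Matroid α} {A U X C : Finset α} {Ind : Finset α → Prop}
    (hInd : ∀ S, Ind S ↔ S ⊆ A ∧ M.Indep (S : Set α)) (hAE : (A : Set α) ⊆ M.E)
    {f : Finset α → ℝ} (hf : MonotoneSubmodular f) (hf0 : 0 ≤ f ∅) {S : ℕ → Finset α}
    (hrun : ∀ i, IsGreedyRun Ind (1 / 8)
      (expect (∑ j ∈ Finset.range i, uniform (1 / 8) (S j)) f) ∅ (S i))
    (hSU : ∀ i < 13, S i ⊆ U) {v : ℝ}
    (hvA : ∀ I : Finset α, I ⊆ A → M.Indep (I : Set α) → f I ≤ v)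
    (hvU : ∀ I : Finset α, I ⊆ U → M.Indep (I : Set α) → f I ≤ v)
    (hXA : X ⊆ A) (hCU : C ⊆ U) (hXC : Disjoint X C)
    (hI : M.Indep ((X ∪ C : Finset α) : Set α)) : 0.505 * f (X ∪ C) ≤ v := by
  have h0 : (0 : ℝ) ≤ 1 / 8 := by norm_num
  have h1 : (1 / 8 : ℝ) ≤ 1 := by norm_num
  have hX : M.Indep (X : Set α) := hI.subset (by exact_mod_cast Finset.subset_union_left)
  have hC : M.Indep (C : Set α) := hI.subset (by exact_mod_cast Finset.subset_union_right)
  have hSi : ∀ i, S i ⊆ A ∧ M.Indep (S i : Set α) := fun i => by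
    have := (hrun i).indep_union ((hInd ∅).2 ⟨Finset.empty_subset _, by simp⟩)
    rw [Finset.union_empty] at this
    exact (hInd _).1 this
  set y : ℕ → Multiset (ℝ × α) := fun i => ∑ j ∈ Finset.range i, uniform (1 / 8) (S j) with hy
  have hyp : ∀ i, IsProb (y i) := fun i => isProb_sum _ _ fun j _ => isProb_uniform h0 h1 (S j)
  choose S' hS'S hS'C hS'I hgain using fun i =>
    (hrun i).exists_gain hInd hAE h0 h1 (hf.expect (hyp i)) hXA hXC hI
  set y' : ℕ → Multiset (ℝ × α) := fun i => ∑ j ∈ Finset.range i, uniform (1 / 8) (S' j) with hy'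
  have hyp' : ∀ i, IsProb (y' i) := fun i => isProb_sum _ _ fun j _ => isProb_uniform h0 h1 (S' j)
  have hyy : ∀ i, y' i ≤ y i := fun i =>
    Finset.sum_le_sum fun j _ => uniform_mono (1 / 8) (hS'S j)
  have hysucc : ∀ i, expect (y (i + 1)) f = expect (uniform (1 / 8) (S i)) (expect (y i) f) :=
    fun i => by rw [← expect_add, add_comm (uniform _ _), hy]; simp only [Finset.sum_range_succ]
  have hysucc' : ∀ i, expect (y' (i + 1)) f = expect (uniform (1 / 8) (S' i)) (expect (y' i) f) :=
    fun i => by rw [← expect_add, add_comm (uniform _ _), hy']; simp only [Finset.sum_range_succ]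
  have hsplit : ∀ {m : Multiset (ℝ × α)}, IsProb m →
      f (X ∪ C) + expect m f ∅ ≤ expect m f X + expect m f C := by
    intro m hm
    have k1 := (hf.expect hm).union_sub_le (Finset.empty_subset C) X
    have k2 := le_expect hf hm (X ∪ C)
    rw [Finset.empty_union, Finset.union_comm C X] at k1
    linarith
  by_contra! hlt
  have hCv : f (X ∪ C) - v ≤ f C := by
    have := hsplit (m := 0) (fun x hx => absurd hx (Multiset.notMem_zero x))
    simp only [expect_zero] at this
    linarith [hvA X hXA hX]
  -- The factor 8/k brings k rounds of weight 1/8 back to total weight one.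
  have hscale : ∀ k : ℕ, 8 ≤ k → (k : ℝ) * (8 / k * (1 / 8)) ≤ 1 ∧ (8 / k : ℝ) ≤ 1 := by
    intro k hk
    have hk' : (8 : ℝ) ≤ k := by exact_mod_cast hk
    refine ⟨by field_simp; rfl, by rw [div_le_one (by linarith)]; exact hk'⟩
  refine contradiction_of_recursion (v := v) (Z := f (X ∪ C)) (p := fun k => expect (y' k) f ∅)
    (q := fun k => expect (y k) f ∅) (E := fun k => expect (y' k) f C)
    (hf0.trans (hvA ∅ (Finset.empty_subset _) (by simp))) hlt ?_ ?_ ?_ ?_ ?_ ?_ ?_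
  · exact hf0.trans (le_expect hf (hyp' 0) ∅)
  · intro k hk
    have k1 := hgain k (expect (y' k) f) (hf.expect (hyp' k))
      (expect_marginalLE_of_le hf (hyy k) (hyp k))
    rw [← hysucc, ← hysucc'] at k1
    have k2 := expect_le_expect_of_le hf (hyy (k + 1)) (hyp (k + 1)) X
    have k3 := hsplit (hyp' (k + 1))
    linarith
  · exact (hf.expect (hyp' 13)).mono _ _ (Finset.empty_subset _)
  · intro k hk
    have hk' : (k : ℝ) ≤ 8 := by exact_mod_cast hk
    have := scaled_expect_le hC hCU hf hvU h0 h1 zero_le_one le_rfl (S := S') (k := k)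
      (by linarith) (fun j hj => (hS'S j).trans (hSU j (by omega))) (fun j _ => hS'C j)
      (fun j _ => hS'I j)
    rwa [sub_self, zero_mul, zero_add, one_mul] at this
  · intro k hk hk13
    have hk' : (8 : ℝ) ≤ k := by exact_mod_cast hk
    have := scaled_expect_le hC hCU hf hvU h0 h1 (by positivity) (hscale k hk).2 (S := S')
      (hscale k hk).1 (fun j hj => (hS'S j).trans (hSU j (by omega))) (fun j _ => hS'C j)
      (fun j _ => hS'I j)
    have k2 := mul_le_mul_of_nonneg_left this (by linarith : (0 : ℝ) ≤ k)
    have k3 := mul_le_mul_of_nonneg_left hCv (by linarith : (0 : ℝ) ≤ k - 8)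
    have k4 : (k : ℝ) * ((1 - 8 / k) * f C + 8 / k * expect (y' k) f C) =
        (k - 8) * f C + 8 * expect (y' k) f C := by field_simp
    rw [k4] at k2
    linarith
  · intro k hk
    have hk' : (k : ℝ) ≤ 8 := by exact_mod_cast hk
    have k1 := convex_expect_le hX hXA hf hvA h0 h1 (S := S) (k := k) (by linarith)
      (fun j _ => (hSi j).1) (fun j _ => (hSi j).2)
    have k2 := convex_expect_le hC hCU hf hvU h0 h1 (S := S) (k := k) (by linarith)
      (fun j hj => hSU j (by omega)) (fun j _ => (hSi j).2)
    -- Adding the bounds for X and for C leaves F(y_k + X) + F(y_k + C), which is at least Z + q_k.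
    have k3 := mul_le_mul_of_nonneg_left (hsplit (hyp k)) (by linarith : (0 : ℝ) ≤ 8 - k)
    linarith
  · intro k hk hk13
    have hk' : (8 : ℝ) ≤ k := by exact_mod_cast hk
    have := scaled_expect_le (M := M) (C := ∅) (by simp) (Finset.empty_subset _) hf hvA h0 h1
      (by positivity) (hscale k hk).2 (S := S) (hscale k hk).1 (fun j _ => (hSi j).1)
      (fun j _ => Finset.disjoint_empty_right _) (fun j _ => by simpa using (hSi j).2)
    have k2 := mul_le_mul_of_nonneg_left this (by linarith : (0 : ℝ) ≤ k)
    have k3 := mul_nonneg (by linarith : (0 : ℝ) ≤ k - 8) hf0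
    have k4 : (k : ℝ) * ((1 - 8 / k) * f ∅ + 8 / k * expect (y k) f ∅) =
        (k - 8) * f ∅ + 8 * expect (y k) f ∅ := by field_simp
    rw [k4] at k2
    linarith

end Analysis

/-! ### Best independent sets from partial oracles. -/

section BestSet

variable {α : Type*}

/-- The oracle for independence, extended by `False`. -/
def extendIndep {U : Finset α} (indep : {S : Finset α // S ⊆ U} → Prop) (S : Finset α) : Prop :=
  ∃ h : S ⊆ U, indep ⟨S, h⟩

theorem extendIndep_iff {U : Finset α} (M : Matroid α) (S : Finset α) :
    extendIndep (fun S : {S : Finset α // S ⊆ U} => M.Indep (S.1 : Set α)) S ↔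
      S ⊆ U ∧ M.Indep (S : Set α) :=
  ⟨fun ⟨h, hi⟩ => ⟨h, hi⟩, fun ⟨h, hi⟩ => ⟨h, hi⟩⟩

open Classical in
/-- An independent subset of `U` of largest value, if there is an independent subset of `U`. -/
noncomputable def bestSet (U : Finset α) (Ind : Finset α → Prop) (f : Finset α → ℝ) : Finset α :=
  if h : ∃ R ⊆ U, Ind R ∧ ∀ I ⊆ U, Ind I → f I ≤ f R then h.choose else ∅

theorem bestSet_subset (U : Finset α) (Ind : Finset α → Prop) (f : Finset α → ℝ) :
    bestSet U Ind f ⊆ U := by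
  rw [bestSet]
  split_ifs with h
  exacts [h.choose_spec.1, Finset.empty_subset _]

theorem bestSet_spec {U : Finset α} {Ind : Finset α → Prop} (h0 : Ind ∅) (f : Finset α → ℝ) :
    Ind (bestSet U Ind f) ∧ ∀ I ⊆ U, Ind I → f I ≤ f (bestSet U Ind f) := by
  classical
  obtain ⟨R, hR, hmax⟩ := Finset.exists_max_image (U.powerset.filter Ind) f
    ⟨∅, Finset.mem_filter.2 ⟨Finset.empty_mem_powerset _, h0⟩⟩
  rw [Finset.mem_filter, Finset.mem_powerset] at hR
  have h : ∃ R ⊆ U, Ind R ∧ ∀ I ⊆ U, Ind I → f I ≤ f R := ⟨R, hR.1, hR.2, fun I hI hInd =>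
    hmax I (Finset.mem_filter.2 ⟨Finset.mem_powerset.2 hI, hInd⟩)⟩
  rw [bestSet, dif_pos h]
  exact h.choose_spec.2

end BestSet

/-! ### The protocol, its message size and its guarantee. -/

section Protocol

variable {α : Type*} [DecidableEq α]

theorem IsMonotoneSubmodularOn.le_union {N : Finset α} {f : Finset α → ℝ}
    (hf : IsMonotoneSubmodularOn N f) {S X : Finset α} (hS : S ⊆ N) (hX : X ⊆ N) :
    f S ≤ f (S ∪ X) := by
  induction X using Finset.induction_on with
  | empty => simp
  | insert u X _ ih =>
    obtain ⟨hu, hX⟩ := Finset.insert_subset_iff.1 hX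
    have := hf.monotone (S ∪ X) (Finset.union_subset hS hX) u hu
    rw [Finset.union_insert]
    linarith [ih hX]

/-- Ignoring elements outside N makes their increments zero, so the analysis can work with a
function on all finite sets. -/
theorem IsMonotoneSubmodularOn.extend {N : Finset α} {f : Finset α → ℝ}
    (hf : IsMonotoneSubmodularOn N f) : MonotoneSubmodular (fun S => f (S ∩ N)) := by
  have hmono : ∀ S T : Finset α, S ⊆ T → f (S ∩ N) ≤ f (T ∩ N) := fun S T h => by
    have := hf.le_union (S := S ∩ N) (X := T ∩ N) Finset.inter_subset_right Finset.inter_subset_right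
    rwa [Finset.union_eq_right.2 (Finset.inter_subset_inter_right h)] at this
  refine ⟨hmono, fun S T u h => ?_⟩
  by_cases hu : u ∈ N
  · by_cases huT : u ∈ T
    · rw [Finset.insert_eq_of_mem huT, sub_self, sub_nonneg]
      exact hmono _ _ (Finset.subset_insert _ _)
    · rw [Finset.insert_inter_of_mem hu, Finset.insert_inter_of_mem hu]
      exact hf.submodular _ _ (Finset.inter_subset_inter_right h) Finset.inter_subset_right u
        (Finset.mem_sdiff.2 ⟨hu, fun hh => huT (Finset.mem_inter.1 hh).1⟩)
  · rw [Finset.insert_inter_of_notMem hu, Finset.insert_inter_of_notMem hu, sub_self, sub_self]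

/-- The value oracle, extended by restricting its argument. -/
def extendVal {U : Finset α} (val : {S : Finset α // S ⊆ U} → ℝ) (S : Finset α) : ℝ :=
  val ⟨S ∩ U, Finset.inter_subset_right⟩

open Classical in
/-- The outcome of a greedy run for `g` from the empty set. -/
noncomputable def greedyBase (Ind : Finset α → Prop) (δ : ℝ) (g : Finset α → ℝ) : Finset α :=
  if h : ∃ S, IsGreedyRun Ind δ g ∅ S then h.choose else ∅

theorem isGreedyRun_greedyBase {Ind : Finset α → Prop} {A : Finset α} (hA : ∀ S, Ind S → S ⊆ A)
    (δ : ℝ) (g : Finset α → ℝ) : IsGreedyRun Ind δ g ∅ (greedyBase Ind δ g) := by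
  obtain ⟨S, -, hS⟩ := exists_isGreedyRun hA δ _ g ∅ rfl
  have h : ∃ S, IsGreedyRun Ind δ g ∅ S := ⟨S, hS⟩
  rw [greedyBase, dif_pos h]
  exact h.choose_spec

theorem IsGreedyRun.subset {Ind : Finset α → Prop} {A : Finset α} (hA : ∀ S, Ind S → S ⊆ A)
    {δ : ℝ} {g : Finset α → ℝ} {I S : Finset α} (hrun : IsGreedyRun Ind δ g I S) : S ⊆ A := by
  induction hrun with
  | nil => exact Finset.empty_subset _
  | cons g I u S huI huS hind hbest hrun ih =>
    exact Finset.insert_subset (hA _ hind (Finset.mem_insert_self _ _)) ih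

/-- The objective after `i` rounds, each of which adds a greedy base of the current objective with
probability `δ` for each of its elements. -/
noncomputable def stage (Ind : Finset α → Prop) (δ : ℝ) (f : Finset α → ℝ) : ℕ → Finset α → ℝ
  | 0 => f
  | i + 1 => expect (uniform δ (greedyBase Ind δ (stage Ind δ f i))) (stage Ind δ f i)

/-- The greedy base that is found in round `i`. -/
noncomputable def roundBase (Ind : Finset α → Prop) (δ : ℝ) (f : Finset α → ℝ) (i : ℕ) :
    Finset α :=
  greedyBase Ind δ (stage Ind δ f i)

theorem stage_eq_expect (Ind : Finset α → Prop) (δ : ℝ) (f : Finset α → ℝ) (i : ℕ) :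
    stage Ind δ f i = expect (∑ j ∈ Finset.range i, uniform δ (roundBase Ind δ f j)) f := by
  induction i with
  | zero => simp [stage]
  | succ i ih =>
    rw [stage, Finset.sum_range_succ, add_comm (Finset.sum _ _), expect_add, ← ih]
    rfl

/-- Alice's message: her best independent set and thirteen successive greedy bases. -/
noncomputable def messageSet (A : Finset α) (Ind : Finset α → Prop) (f : Finset α → ℝ) :
    Finset α :=
  bestSet A Ind f ∪ (Finset.range 13).biUnion (roundBase Ind (1 / 8) f)

/-- Alice sends `messageSet`, and Bob returns the best independent set that he sees. -/
noncomputable def greedyProtocol (α : Type*) [DecidableEq α] : TwoPlayerProtocol α where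
  alice A indep val := messageSet A (extendIndep indep) (extendVal val)
  alice_subset A indep val := by
    refine Finset.union_subset (bestSet_subset _ _ _) (Finset.biUnion_subset.2 fun i _ => ?_)
    exact (isGreedyRun_greedyBase (fun S hS => hS.1) _ _).subset (fun S hS => hS.1)
  bob Q B indep val := bestSet (Q ∪ B) (extendIndep indep) (extendVal val)
  bob_subset Q B indep val := bestSet_subset _ _ _

theorem card_messageSet_le {A : Finset α} {Ind : Finset α → Prop} (hA : ∀ S, Ind S → S ⊆ A)
    (h0 : Ind ∅) (f : Finset α → ℝ) {k : ℕ} (hk : ∀ S, Ind S → S.card ≤ k) :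
    (messageSet A Ind f).card ≤ 14 * k := by
  have h1 : ((Finset.range 13).biUnion (roundBase Ind (1 / 8) f)).card ≤ 13 * k := by
    have := Finset.card_biUnion_le_card_mul (Finset.range 13) (roundBase Ind (1 / 8) f) k
      fun i _ => hk _ (by
        have := (isGreedyRun_greedyBase hA (1 / 8) (stage Ind (1 / 8) f i)).indep_union h0
        rwa [Finset.union_empty] at this)
    rwa [Finset.card_range] at this
  have h2 := Finset.card_union_le (bestSet A Ind f)
    ((Finset.range 13).biUnion (roundBase Ind (1 / 8) f))
  have h3 := hk _ (bestSet_spec (U := A) h0 f).1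
  rw [messageSet]
  omega

theorem extendVal_eq {U : Finset α} (f : Finset α → ℝ) {S : Finset α} (hS : S ⊆ U) :
    extendVal (fun S : {S : Finset α // S ⊆ U} => f S.1) S = f S :=
  congrArg f (Finset.inter_eq_left.2 hS)

/-- Whoever sees Alice's message together with `B` can find a `0.505`-approximate solution. -/
theorem messageSet_guarantee {M : Matroid α} {A B U : Finset α} (hAB : Disjoint A B)
    (hE : M.E = ((A ∪ B : Finset α) : Set α)) {f : Finset α → ℝ}
    (hf : IsMonotoneSubmodularOn (A ∪ B) f) {Ind : Finset α → Prop}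
    (hInd : ∀ S, Ind S ↔ S ⊆ A ∧ M.Indep (S : Set α)) {fA : Finset α → ℝ}
    (hfA : ∀ S, S ⊆ A → fA S = f S) (hQU : messageSet A Ind fA ⊆ U) (hBU : B ⊆ U)
    (hUN : U ⊆ A ∪ B) {v : ℝ}
    (hv : ∀ I : Finset α, I ⊆ U → M.Indep (I : Set α) → f I ≤ v) {I : Finset α}
    (hI : M.Indep (I : Set α)) : 0.505 * f I ≤ v := by
  have hIndA : ∀ S, Ind S → S ⊆ A := fun S hS => ((hInd S).1 hS).1
  have hInd0 : Ind ∅ := (hInd ∅).2 ⟨Finset.empty_subset _, by simp⟩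
  have hIN : I ⊆ A ∪ B := by
    have := hI.subset_ground
    rw [hE] at this
    exact_mod_cast this
  obtain ⟨fN, hfN⟩ : ∃ fN : Finset α → ℝ, fN = fun S => f (S ∩ (A ∪ B)) := ⟨_, rfl⟩
  have hfNm : MonotoneSubmodular fN := hfN ▸ hf.extend
  have hfN' : ∀ S, S ⊆ A ∪ B → fN S = f S := fun S hS => by
    rw [hfN]
    exact congrArg f (Finset.inter_eq_left.2 hS)
  have hAN : ∀ S, S ⊆ A → fA S = fN S := fun S hS => by
    rw [hfA S hS, hfN' S (hS.trans Finset.subset_union_left)]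
  obtain ⟨hbest, hmax⟩ := bestSet_spec (U := A) hInd0 fA
  have hbestA := bestSet_subset A Ind fA
  have hbestU : bestSet A Ind fA ⊆ U := Finset.subset_union_left.trans hQU
  have hsub : ∀ i, roundBase Ind (1 / 8) fA i ⊆ A := fun i =>
    (isGreedyRun_greedyBase hIndA _ _).subset hIndA
  have hsplit : I ∩ A ∪ I ∩ B = I := by
    rw [← Finset.inter_union_distrib_left, Finset.inter_eq_left.2 hIN]
  have hrun : ∀ i, IsGreedyRun Ind (1 / 8)
      (expect (∑ j ∈ Finset.range i, uniform (1 / 8) (roundBase Ind (1 / 8) fA j)) fN) ∅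
      (roundBase Ind (1 / 8) fA i) := fun i => by
    refine (isGreedyRun_greedyBase hIndA (1 / 8) (stage Ind (1 / 8) fA i)).congr hIndA
      fun S hS => ?_
    rw [stage_eq_expect]
    refine expect_congr hAN (fun x hx => ?_) hS
    obtain ⟨j, -, hxj⟩ := Multiset.mem_sum.1 hx
    obtain ⟨u, hu, rfl⟩ := Multiset.mem_map.1 hxj
    exact hsub j hu
  have key := greedy_bases_guarantee (U := U) (X := I ∩ A) (C := I ∩ B) (v := v) hInd
    (by rw [hE]; exact_mod_cast Finset.subset_union_left) hfNm
    (by rw [hfN' ∅ (Finset.empty_subset _)]; exact hf.nonneg ∅ (Finset.empty_subset _)) hrun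
    (fun i hi => (Finset.subset_biUnion_of_mem (roundBase Ind (1 / 8) fA)
      (Finset.mem_range.2 hi)).trans (Finset.subset_union_right.trans hQU))
    -- The bound on A holds because Alice's best set is part of the message and thus visible in U.
    (fun J hJ hi => by
      rw [← hAN J hJ]
      refine (hmax J hJ ((hInd J).2 ⟨hJ, hi⟩)).trans ?_
      rw [hfA _ hbestA]
      exact hv _ hbestU ((hInd _).1 hbest).2)
    (fun J hJ hi => by rw [hfN' J (hJ.trans hUN)]; exact hv J hJ hi)
    Finset.inter_subset_right (Finset.inter_subset_right.trans hBU)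
    (Finset.disjoint_of_subset_left Finset.inter_subset_right
      (Finset.disjoint_of_subset_right Finset.inter_subset_right hAB))
    (by rwa [hsplit])
  rwa [hsplit, hfN' I hIN] at key

attribute [irreducible] bestSet messageSet

theorem card_greedyProtocol_message_le (M : Matroid α) (f : Finset α → ℝ) (A : Finset α) {k : ℕ}
    (hk : M.eRank = (k : ℕ∞)) : ((greedyProtocol α).message M f A).card ≤ 14 * k := by
  refine card_messageSet_le (fun S hS => ((extendIndep_iff M S).1 hS).1)
    ((extendIndep_iff M ∅).2 ⟨Finset.empty_subset _, by simp⟩) _ fun S hS => ?_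
  have := ((extendIndep_iff M S).1 hS).2.encard_le_eRank
  rw [hk, Set.encard_coe_eq_coe_finsetCard] at this
  exact_mod_cast this

theorem greedyProtocol_output_spec (M : Matroid α) (f : Finset α → ℝ) (A B : Finset α) :
    ((greedyProtocol α).output M f A B ⊆ (greedyProtocol α).message M f A ∪ B ∧
      M.Indep ((greedyProtocol α).output M f A B : Set α)) ∧
    ∀ I : Finset α, I ⊆ (greedyProtocol α).message M f A ∪ B → M.Indep (I : Set α) →
      f I ≤ f ((greedyProtocol α).output M f A B) := by
  generalize hQ : (greedyProtocol α).message M f A = Q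
  have hout : (greedyProtocol α).output M f A B = bestSet (Q ∪ B)
      (extendIndep fun S : {S : Finset α // S ⊆ Q ∪ B} => M.Indep (S.1 : Set α))
      (extendVal fun S : {S : Finset α // S ⊆ Q ∪ B} => f S.1) := by
    rw [← hQ]
    rfl
  obtain ⟨hR, hmax⟩ := bestSet_spec (U := Q ∪ B)
    (Ind := extendIndep fun S : {S : Finset α // S ⊆ Q ∪ B} => M.Indep (S.1 : Set α))
    ((extendIndep_iff M ∅).2 ⟨Finset.empty_subset _, by simp⟩)
    (extendVal fun S : {S : Finset α // S ⊆ Q ∪ B} => f S.1)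
  rw [← hout, extendIndep_iff] at hR
  rw [← hout] at hmax
  refine ⟨hR, fun I hI hi => ?_⟩
  have := hmax I hI ((extendIndep_iff M I).2 ⟨hI, hi⟩)
  rwa [extendVal_eq f hI, extendVal_eq f hR.1] at this

end Protocol

/-! ### The main theorem. -/

theorem theorem3 :
    ∃ c : ℕ, ∀ (α : Type*) [DecidableEq α], ∃ P : TwoPlayerProtocol α,
      ∀ (A B : Finset α), Disjoint A B →
      ∀ (M : Matroid α), M.E = ((A ∪ B : Finset α) : Set α) →
      ∀ (k : ℕ), M.eRank = (k : ℕ∞) →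
      ∀ (f : Finset α → ℝ), IsMonotoneSubmodularOn (A ∪ B) f →
        (P.message M f A).card ≤ c * k ∧
        M.Indep (P.output M f A B : Set α) ∧
        ∀ I : Finset α, M.Indep (I : Set α) → 0.505 * f I ≤ f (P.output M f A B) := by
  refine ⟨14, fun α _ => ⟨greedyProtocol α, fun A B hAB M hE k hk f hf => ?_⟩⟩
  obtain ⟨hR, hmax⟩ := greedyProtocol_output_spec M f A B
  refine ⟨card_greedyProtocol_message_le M f A hk, hR.2, fun I hI => ?_⟩
  exact messageSet_guarantee hAB hE hf (extendIndep_iff M) (fun S hS => extendVal_eq f hS)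
    Finset.subset_union_left Finset.subset_union_right
    (Finset.union_subset_union_left ((greedyProtocol α).alice_subset A _ _)) hmax hI
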